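/- Let $U\subseteq\mathbb R^n$ be open. Write $\mathcal D(U)$, $\mathcal D'(U)$ for the (complex) test functions and distributions on $U$. For a locally convex space $F$ let $C^\infty(U,F)$ be the space of maps $U\to F$ all of whose iterated partial derivatives exist and are continuous, with the topology of uniform convergence of all derivatives on compact sets, and $C^\infty(U)=C^\infty(U,\mathbb C)$. Put $SK(U)=C^\infty(U,\mathcal D(U))$ (smoothing kernels). A map $R\colon SK(U)\to C^\infty(U)$ is called smooth if it maps smooth curves $\mathbb R\to SK(U)$ to smooth curves $\mathbb R\to C^\infty(U)$, and local if $\vec\varphi|_W=\vec\psi|_W$ implies $R(\vec\varphi)|_W=R(\vec\psi)|_W$ for all open $W\subseteq U$ and $\vec\varphi,\vec\psi\in SK(U)$. Let $\mathcal E_{\mathrm{loc}}(U)$ be the vector space of all smooth local maps $SK(U)\to C^\infty(U)$. For $V\subseteq U$ open and $R\in\mathcal E_{\mathrm{loc}}(U)$, the restriction $R|_V$ is the unique element of $\mathcal E_{\mathrm{loc}}(V)$ such that $R|_V(\vec\varphi)|_W=R(\vec\psi)|_W$ whenever $W$ is open, $\overline W\subseteq V$, $\vec\varphi\in SK(V)$,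 $\vec\psi\in SK(U)$ and $\vec\varphi|_W=\vec\psi|_W$. A sequence $(\vec\varphi_k)_k$ in $SK(U)$ is localizing if every $x\in U$ has an open neighborhood $W\subseteq U$ such that for every $r>0$ there is $k_0$ with $\operatorname{supp}\vec\varphi_k(y)\subseteq\overline{B_r}(y)$ for all $k\ge k_0$ and $y\in W$. Let $\mathcal N(U)$ be the set of those $R\in\mathcal E_{\mathrm{loc}}(U)$ such that for each localizing sequence $(\vec\varphi_k)_k$ every $x\in U$ has an open neighborhood on which $R(\vec\varphi_k)$ vanishes for all large $k$. Put $\tilde{\mathcal E}_{\mathrm{loc}}(U)=\mathcal E_{\mathrm{loc}}(U)/\mathcal N(U)$, with restriction $[R]|_V=[R|_V]$, and let $\tilde\iota_U\colon\mathcal D'(U)\to\tilde{\mathcal E}_{\mathrm{loc}}(U)$ be the linear map $u\mapsto[\iota u]$, where $(\iota u)(\vec\varphi)(x)=\langle u,\vec\varphi(x)\rangle$. The support of $\xi\in\tilde{\mathcal E}_{\mathrm{loc}}(U)$ is the set of those $x\in U$ such that $\xi|_V\neq0$ for each open neighborhood $V\subseteq U$ of $x$; the support of $u \in \mathcal D'(U)$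 is likewise taken in $U$. Then: (i) $\tilde\iota_U$ is injective. (ii) $(\tilde\iota_U u)|_V=\tilde\iota_V(u|_V)$ for any open $V\subseteq U$ and $u\in\mathcal D'(U)$; that is, $\tilde\iota$ is a morphism of sheaves. (iii) $\operatorname{supp}u=\operatorname{supp}\tilde\iota_U u$ for all $u\in\mathcal D'(U)$. -/

import Mathlib

noncomputable section

namespace Colombeau

open scoped Topology Distributions ContDiff
open Filter Set TopologicalSpace

/-! ### Smooth curves and smooth maps between topological vector spaces (convenient calculus) -/

section Curves

variable {G H : Type*} [AddCommGroup G] [Module ℝ G] [TopologicalSpace G]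
  [AddCommGroup H] [Module ℝ H] [TopologicalSpace H]

/-- The curve `c` has derivative `g` at `t`: the difference quotients converge to `g`. -/
def HasCurveDerivAt (c : ℝ → G) (g : G) (t : ℝ) : Prop :=
  Tendsto (fun h : ℝ => h⁻¹ • (c (t + h) - c t)) (𝓝[≠] 0) (𝓝 g)

/-- `c ∈ C^∞(ℝ, G)`: derivatives of all orders exist (hence all are continuous). -/
def IsSmoothCurve (c : ℝ → G) : Prop :=
  ∃ D : ℕ → ℝ → G, D 0 = c ∧ ∀ k t, HasCurveDerivAt (D k) (D (k + 1) t) t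

/-- `R : G → H` is smooth: it maps smooth curves to smooth curves. -/
def IsConvenientlySmooth (R : G → H) : Prop :=
  ∀ c : ℝ → G, IsSmoothCurve c → IsSmoothCurve (fun t => R (c t))

theorem HasCurveDerivAt.unique [T2Space G] {c : ℝ → G} {g g' : G} {t : ℝ}
    (h : HasCurveDerivAt c g t) (h' : HasCurveDerivAt c g' t) : g = g' :=
  tendsto_nhds_unique h h'

theorem HasCurveDerivAt.map {c : ℝ → G} {g : G} {t : ℝ} (h : HasCurveDerivAt c g t)
    (L : G →ₗ[ℝ] H) (hL : Continuous L) : HasCurveDerivAt (fun s => L (c s)) (L g) t := by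
  have := (hL.tendsto g).comp h
  refine this.congr fun s => ?_
  simp

theorem IsSmoothCurve.map {c : ℝ → G} (h : IsSmoothCurve c)
    (L : G →ₗ[ℝ] H) (hL : Continuous L) : IsSmoothCurve (fun s => L (c s)) := by
  obtain ⟨D, rfl, hD⟩ := h
  exact ⟨fun k s => L (D k s), rfl, fun k t => (hD k t).map L hL⟩

theorem IsSmoothCurve.add [IsTopologicalAddGroup G] {c d : ℝ → G} (hc : IsSmoothCurve c)
    (hd : IsSmoothCurve d) : IsSmoothCurve (fun s => c s + d s) := by
  obtain ⟨C, rfl, hC⟩ := hc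
  obtain ⟨D, rfl, hD⟩ := hd
  refine ⟨fun k s => C k s + D k s, rfl, fun k t => ?_⟩
  refine ((hC k t).add (hD k t)).congr fun s => ?_
  rw [← smul_add, add_sub_add_comm]

theorem isSmoothCurve_const (g : G) : IsSmoothCurve (fun _ => g) := by
  refine ⟨fun k _ => if k = 0 then g else 0, by simp, fun k t => ?_⟩
  simp only [HasCurveDerivAt, sub_self, smul_zero, Nat.add_eq_zero_iff, one_ne_zero, and_false,
    if_false]
  exact tendsto_const_nhds

end Curves

/-! ### The space `C^∞(U, F)` of smooth maps on an open set with values in a locally convex space -/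

/-- Euclidean space `ℝⁿ`. -/
abbrev Rn (n : ℕ) := EuclideanSpace ℝ (Fin n)

/-- The standard basis vectors of `ℝⁿ`. -/
abbrev stdVec {n : ℕ} (i : Fin n) : Rn n := EuclideanSpace.single i 1

section SmoothMaps

variable {n : ℕ} {U V : Opens (Rn n)} {F F' : Type*}

section ZeroExt

open Classical in
/-- Extension by zero of a function on `U`, used only to write difference quotients. -/
def zeroExt [Zero F] (f : U → F) (y : Rn n) : F :=
  if hy : y ∈ U then f ⟨y, hy⟩ else 0

theorem zeroExt_of_mem [Zero F] (f : U → F) {y : Rn n} (hy : y ∈ U) :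
    zeroExt f y = f ⟨y, hy⟩ := by
  simp [zeroExt, hy]

theorem zeroExt_of_notMem [Zero F] (f : U → F) {y : Rn n} (hy : y ∉ U) :
    zeroExt f y = 0 := by
  simp [zeroExt, hy]

theorem zeroExt_coe [Zero F] (f : U → F) (x : U) : zeroExt f (x : Rn n) = f x := by
  simp [zeroExt]

end ZeroExt

variable [AddCommGroup F] [Module ℝ F] [TopologicalSpace F]
  [AddCommGroup F'] [Module ℝ F'] [TopologicalSpace F']

/-- The `i`-th partial derivative of `f : U → F` at `x ∈ U` exists and equals `g`. Since `U` is
open, the values of `zeroExt f` outside of `U` play no role. -/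
def HasPartialDerivAt (f : U → F) (i : Fin n) (g : F) (x : U) : Prop :=
  Tendsto (fun h : ℝ => h⁻¹ • (zeroExt f ((x : Rn n) + h • stdVec i) - f x)) (𝓝[≠] 0) (𝓝 g)

/-- `D` is a system of all iterated partial derivatives of `f`, all of them continuous: `D []`
is `f`, and `D (i :: l)` is the `i`-th partial derivative of `D l`. -/
structure IsDerivSystem (f : U → F) (D : List (Fin n) → U → F) : Prop where
  nil : D [] = f
  cont : ∀ l, Continuous (D l)
  deriv : ∀ l i x, HasPartialDerivAt (D l) i (D (i :: l) x) x

/-- `f ∈ C^∞(U, F)`: all iterated partial derivatives of `f` exist and are continuous. -/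
def IsSmooth (f : U → F) : Prop := ∃ D : List (Fin n) → U → F, IsDerivSystem f D

theorem tendsto_line (x : Rn n) (i : Fin n) :
    Tendsto (fun h : ℝ => x + h • stdVec i) (𝓝[≠] 0) (𝓝 x) := by
  have : Continuous fun h : ℝ => x + h • (stdVec i : Rn n) := by fun_prop
  have h0 := this.tendsto 0
  simp only [zero_smul, add_zero] at h0
  exact h0.mono_left nhdsWithin_le_nhds

theorem HasPartialDerivAt.unique [T2Space F] {f : U → F} {i : Fin n} {g g' : F} {x : U}
    (h : HasPartialDerivAt f i g x) (h' : HasPartialDerivAt f i g' x) : g = g' :=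
  tendsto_nhds_unique h h'

/-- Partial derivatives depend only on the germ. -/
theorem HasPartialDerivAt.congr {f : U → F} {f' : V → F} {i : Fin n} {g : F} {x : U} {x' : V}
    (hx : (x : Rn n) = x') (h : HasPartialDerivAt f i g x)
    (he : ∀ᶠ y in 𝓝 (x : Rn n), zeroExt f y = zeroExt f' y) : HasPartialDerivAt f' i g x' := by
  have h1 : f x = f' x' := by
    have := he.self_of_nhds
    rw [zeroExt_coe] at this
    rw [this, hx, zeroExt_coe]
  refine Tendsto.congr' ?_ h
  filter_upwards [(tendsto_line (x : Rn n) i).eventually he] with t ht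
  rw [ht, h1, hx]

theorem HasPartialDerivAt.add [IsTopologicalAddGroup F] {f f' : U → F} {i : Fin n} {g g' : F}
    {x : U} (h : HasPartialDerivAt f i g x) (h' : HasPartialDerivAt f' i g' x) :
    HasPartialDerivAt (f + f') i (g + g') x := by
  refine (Tendsto.add h h').congr fun t => ?_
  rw [← smul_add]
  congr 1
  by_cases hy : (x : Rn n) + t • stdVec i ∈ U
  · simp only [zeroExt_of_mem _ hy, Pi.add_apply]; abel
  · simp only [zeroExt_of_notMem _ hy, Pi.add_apply]; abel

theorem HasPartialDerivAt.map {f : U → F} {i : Fin n} {g : F} {x : U}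
    (h : HasPartialDerivAt f i g x) (L : F →ₗ[ℝ] F') (hL : Continuous L) :
    HasPartialDerivAt (fun y => L (f y)) i (L g) x := by
  refine ((hL.tendsto g).comp h).congr fun t => ?_
  by_cases hy : (x : Rn n) + t • stdVec i ∈ U
  · simp [zeroExt_of_mem _ hy]
  · simp [zeroExt_of_notMem _ hy]

theorem IsDerivSystem.add [IsTopologicalAddGroup F] {f f' : U → F}
    {D D' : List (Fin n) → U → F} (h : IsDerivSystem f D) (h' : IsDerivSystem f' D') :
    IsDerivSystem (f + f') (fun l => D l + D' l) :=
  ⟨by rw [h.nil, h'.nil], fun l => (h.cont l).add (h'.cont l),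
    fun l i x => (h.deriv l i x).add (h'.deriv l i x)⟩

theorem IsDerivSystem.map {f : U → F} {D : List (Fin n) → U → F} (h : IsDerivSystem f D)
    (L : F →ₗ[ℝ] F') (hL : Continuous L) :
    IsDerivSystem (fun y => L (f y)) (fun l y => L (D l y)) :=
  ⟨by rw [h.nil], fun l => hL.comp (h.cont l), fun l i x => (h.deriv l i x).map L hL⟩

theorem isDerivSystem_zero : IsDerivSystem (0 : U → F) (fun _ => 0) := by
  refine ⟨rfl, fun _ => continuous_zero, fun l i x => ?_⟩
  refine (tendsto_const_nhds (x := (0 : F))).congr fun t => ?_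
  by_cases hy : (x : Rn n) + t • stdVec i ∈ U
  · simp [zeroExt_of_mem _ hy]
  · simp [zeroExt_of_notMem _ hy]

/-- Derivative systems depend only on germs. -/
theorem IsDerivSystem.eq_of_germ [T2Space F] {f : U → F} {f' : V → F}
    {D D' : List (Fin n) → _} (h : IsDerivSystem f D) (h' : IsDerivSystem f' D') {x : Rn n}
    (hU : x ∈ U) (hV : x ∈ V)
    (he : ∀ᶠ y in 𝓝 x, zeroExt f y = zeroExt f' y) (l : List (Fin n)) :
    D l ⟨x, hU⟩ = D' l ⟨x, hV⟩ := by
  have key : ∀ᶠ y in 𝓝 x, zeroExt (D l) y = zeroExt (D' l) y := by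
    induction l with
    | nil => rw [h.nil, h'.nil]; exact he
    | cons i l ih =>
      filter_upwards [eventually_eventually_nhds.2 ih, U.isOpen.mem_nhds hU,
        V.isOpen.mem_nhds hV] with y hy hyU hyV
      rw [zeroExt_of_mem _ hyU, zeroExt_of_mem _ hyV]
      exact ((h.deriv l i ⟨y, hyU⟩).congr (f' := D' l) (x := ⟨y, hyU⟩) (x' := ⟨y, hyV⟩) rfl hy).unique
        (h'.deriv l i ⟨y, hyV⟩)
  have := key.self_of_nhds
  rwa [zeroExt_of_mem _ hU, zeroExt_of_mem _ hV] at this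

theorem IsDerivSystem.unique [T2Space F] {f : U → F} {D D' : List (Fin n) → U → F}
    (h : IsDerivSystem f D) (h' : IsDerivSystem f D') (l : List (Fin n)) : D l = D' l :=
  funext fun x => h.eq_of_germ h' x.2 x.2 (Eventually.of_forall fun _ => rfl) l

/-- A set of continuous functions which is closed under taking partial derivatives consists of
smooth functions. -/
theorem isSmooth_of_closed (S : Set (U → F)) (hS : ∀ f ∈ S, Continuous f ∧ ∀ i, ∃ g ∈ S,
    ∀ x, HasPartialDerivAt f i (g x) x) : ∀ f ∈ S, IsSmooth f := by
  intro f hf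
  choose! d hdS hd using fun f hf => (hS f hf).2
  let D : List (Fin n) → S := fun l => l.foldr (fun i g => ⟨d g.1 i, hdS g.1 g.2 i⟩) ⟨f, hf⟩
  exact ⟨fun l => (D l).1, rfl, fun l => (hS _ (D l).2).1, fun l i x => hd _ (D l).2 i x⟩

end SmoothMaps

section CInf

variable {n : ℕ} (U : Opens (Rn n)) (F : Type*) [AddCommGroup F] [Module ℂ F] [Module ℝ F]
  [IsScalarTower ℝ ℂ F] [TopologicalSpace F] [IsTopologicalAddGroup F] [ContinuousConstSMul ℂ F]

/-- Smooth maps `U → F` as a subspace of all maps. -/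
def smoothMaps : Submodule ℂ (U → F) where
  carrier := {f | IsSmooth f}
  add_mem' := by
    rintro f g ⟨D, hD⟩ ⟨D', hD'⟩
    exact ⟨_, hD.add hD'⟩
  zero_mem' := ⟨_, isDerivSystem_zero⟩
  smul_mem' := by
    rintro c f ⟨D, hD⟩
    exact ⟨_, hD.map ((LinearMap.lsmul ℂ F c).restrictScalars ℝ) (continuous_const_smul c)⟩

/-- The space `C^∞(U, F)`. -/
def CInf : Type _ := ↥(smoothMaps U F)

instance : AddCommGroup (CInf U F) := inferInstanceAs (AddCommGroup ↥(smoothMaps U F))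
instance : Module ℂ (CInf U F) := inferInstanceAs (Module ℂ ↥(smoothMaps U F))
instance : Module ℝ (CInf U F) := inferInstanceAs (Module ℝ ↥(smoothMaps U F))
instance : IsScalarTower ℝ ℂ (CInf U F) :=
  inferInstanceAs (IsScalarTower ℝ ℂ ↥(smoothMaps U F))

variable {U F}

instance : FunLike (CInf U F) U F where
  coe f := f.1
  coe_injective _ _ h := Subtype.ext h

namespace CInf

theorem isSmooth (f : CInf U F) : IsSmooth (f : U → F) := f.2

/-- Bundle a smooth function. -/
def mk (f : U → F) (hf : IsSmooth f) : CInf U F := ⟨f, hf⟩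

@[simp] theorem mk_apply (f : U → F) (hf : IsSmooth f) (x : U) : mk f hf x = f x := rfl
@[simp] theorem add_apply (f g : CInf U F) (x : U) : (f + g) x = f x + g x := rfl
@[simp] theorem sub_apply (f g : CInf U F) (x : U) : (f - g) x = f x - g x := rfl
@[simp] theorem zero_apply (x : U) : (0 : CInf U F) x = 0 := rfl
@[simp] theorem smul_apply (c : ℂ) (f : CInf U F) (x : U) : (c • f) x = c • f x := rfl
@[simp] theorem real_smul_apply (c : ℝ) (f : CInf U F) (x : U) : (c • f) x = c • f x := rfl

@[ext] theorem ext {f g : CInf U F} (h : ∀ x, f x = g x) : f = g := DFunLike.ext _ _ h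

/-- The iterated partial derivative of `f` given by a list of indices; it is continuous. -/
def iterPartial (l : List (Fin n)) (f : CInf U F) : C(U, F) :=
  ⟨f.isSmooth.choose l, f.isSmooth.choose_spec.cont l⟩

theorem isDerivSystem (f : CInf U F) : IsDerivSystem f (fun l => f.iterPartial l) :=
  f.isSmooth.choose_spec

/-- The topology of `C^∞(U, F)`: convergence of all iterated partial derivatives in the
compact-open topology, i.e. uniformly on compact sets. -/
instance : TopologicalSpace (CInf U F) :=
  TopologicalSpace.induced (fun f (l : List (Fin n)) => f.iterPartial l) inferInstance

theorem iterPartial_eq [T2Space F] {f : CInf U F} {D : List (Fin n) → U → F}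
    (h : IsDerivSystem f D) (l : List (Fin n)) (x : U) : f.iterPartial l x = D l x :=
  congrFun (f.isDerivSystem.unique h l) x

theorem iterPartial_nil (f : CInf U F) (x : U) : f.iterPartial [] x = f x :=
  congrFun f.isDerivSystem.nil x

theorem continuous_coe (f : CInf U F) : Continuous (f : U → F) := by
  have := f.isDerivSystem.cont []
  rwa [f.isDerivSystem.nil] at this

theorem iterPartial_add [T2Space F] (f g : CInf U F) (l : List (Fin n)) :
    (f + g).iterPartial l = f.iterPartial l + g.iterPartial l :=
  ContinuousMap.ext fun x => iterPartial_eq (f := f + g) (f.isDerivSystem.add g.isDerivSystem) l x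

theorem iterPartial_smul [T2Space F] (c : ℂ) (f : CInf U F) (l : List (Fin n)) :
    (c • f).iterPartial l = c • f.iterPartial l :=
  ContinuousMap.ext fun x => iterPartial_eq (f := c • f)
    (f.isDerivSystem.map ((LinearMap.lsmul ℂ F c).restrictScalars ℝ) (continuous_const_smul c)) l x

/-- All iterated partial derivatives together, as a linear map. -/
def iterPartialₗ [T2Space F] : CInf U F →ₗ[ℂ] (List (Fin n) → C(U, F)) where
  toFun f l := f.iterPartial l
  map_add' f g := funext fun l => iterPartial_add f g l
  map_smul' c f := funext fun l => iterPartial_smul c f l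

theorem topology_eq [T2Space F] : (inferInstance : TopologicalSpace (CInf U F)) =
    TopologicalSpace.induced (iterPartialₗ (U := U) (F := F)) inferInstance := rfl

theorem tendsto_iff {α : Type*} {p : Filter α} {f : α → CInf U F} {g : CInf U F} :
    Tendsto f p (𝓝 g) ↔ ∀ l, Tendsto (fun a => (f a).iterPartial l) p (𝓝 (g.iterPartial l)) := by
  rw [nhds_induced, tendsto_comap_iff, tendsto_pi_nhds]
  rfl

theorem continuous_iff {α : Type*} [TopologicalSpace α] {f : α → CInf U F} :
    Continuous f ↔ ∀ l, Continuous fun a => (f a).iterPartial l := by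
  rw [continuous_induced_rng, continuous_pi_iff]
  rfl

theorem continuous_iterPartial (l : List (Fin n)) :
    Continuous fun f : CInf U F => f.iterPartial l :=
  continuous_iff.1 continuous_id l

instance [T2Space F] : IsTopologicalAddGroup (CInf U F) :=
  topologicalAddGroup_induced (iterPartialₗ (U := U) (F := F))

instance [T2Space F] : ContinuousConstSMul ℂ (CInf U F) :=
  ⟨fun c => continuous_iff.2 fun l => by
    simp only [iterPartial_smul]
    exact (continuous_iterPartial l).const_smul c⟩

theorem continuous_eval (x : U) : Continuous fun f : CInf U F => f x := by
  have : Continuous fun f : CInf U F => f.iterPartial [] x :=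
    (ContinuousEvalConst.continuous_eval_const x).comp (continuous_iterPartial [])
  simpa only [iterPartial_nil] using this

end CInf

end CInf

/-! ### Localization of smooth maps and of smooth curves -/

section Local

set_option linter.unusedSectionVars false

variable {n : ℕ} {U V : Opens (Rn n)} {F F' : Type*}
  [AddCommGroup F] [Module ℂ F] [Module ℝ F]
  [IsScalarTower ℝ ℂ F] [TopologicalSpace F] [IsTopologicalAddGroup F] [ContinuousConstSMul ℂ F]
  [AddCommGroup F'] [Module ℂ F'] [Module ℝ F']
  [IsScalarTower ℝ ℂ F'] [TopologicalSpace F'] [IsTopologicalAddGroup F']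
  [ContinuousConstSMul ℂ F']

theorem eventually_zeroExt_eq {G : Type*} [Zero G] {f : U → G} {g : V → G} (W : Opens (Rn n))
    {x : Rn n} (hU : x ∈ U) (hV : x ∈ V) (hW : x ∈ W)
    (h : ∀ y (hyU : y ∈ U) (hyV : y ∈ V), y ∈ W → f ⟨y, hyU⟩ = g ⟨y, hyV⟩) :
    ∀ᶠ y in 𝓝 x, zeroExt f y = zeroExt g y := by
  filter_upwards [U.isOpen.mem_nhds hU, V.isOpen.mem_nhds hV, W.isOpen.mem_nhds hW] with y h1 h2 h3
  rw [zeroExt_of_mem _ h1, zeroExt_of_mem _ h2, h y h1 h2 h3]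

theorem CInf.iterPartial_germ [T2Space F] (f : CInf U F) (g : CInf V F) (W : Opens (Rn n))
    {x : Rn n} (hU : x ∈ U) (hV : x ∈ V) (hW : x ∈ W)
    (h : ∀ y (hyU : y ∈ U) (hyV : y ∈ V), y ∈ W → f ⟨y, hyU⟩ = g ⟨y, hyV⟩) (l : List (Fin n)) :
    f.iterPartial l ⟨x, hU⟩ = g.iterPartial l ⟨x, hV⟩ :=
  f.isDerivSystem.eq_of_germ g.isDerivSystem hU hV (eventually_zeroExt_eq W hU hV hW h) l

theorem isSmooth_of_local [T2Space F] (hVU : V ≤ U) (f : V → F)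
    (hloc : ∀ x : V, ∃ (g : CInf U F) (W : Opens (Rn n)), (x : Rn n) ∈ W ∧
      ∀ y (hy : y ∈ V), y ∈ W → f ⟨y, hy⟩ = g ⟨y, hVU hy⟩) : IsSmooth f := by
  choose g W hxW hg using hloc
  have hA : ∀ (x : V) (y : V), (y : Rn n) ∈ W x → ∀ l,
      (g y).iterPartial l ⟨y, hVU y.2⟩ = (g x).iterPartial l ⟨y, hVU y.2⟩ := by
    intro x y hy l
    refine (g y).iterPartial_germ (g x) (W x ⊓ W y ⊓ V) _ _ ⟨⟨hy, hxW y⟩, y.2⟩ ?_ l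
    rintro z hz1 hz2 ⟨⟨hz3, hz4⟩, hz5⟩
    rw [← hg y z hz5 hz4, ← hg x z hz5 hz3]
  let D : List (Fin n) → V → F := fun l x => (g x).iterPartial l ⟨x, hVU x.2⟩
  refine ⟨D, ?_, fun l => ?_, fun l i x => ?_⟩
  · funext x
    exact (CInf.iterPartial_nil (g x) _).trans (hg x x x.2 (hxW x)).symm
  · rw [continuous_iff_continuousAt]
    intro x
    have hc : Continuous fun y : V => (g x).iterPartial l ⟨y, hVU y.2⟩ :=
      ((g x).iterPartial l).continuous.comp (by fun_prop)
    refine hc.continuousAt.congr ?_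
    filter_upwards [((W x).isOpen.preimage continuous_subtype_val).mem_nhds (hxW x)] with y hy
    exact (hA x y hy l).symm
  · refine ((g x).isDerivSystem.deriv l i ⟨x, hVU x.2⟩).congr (f' := D l)
      (x := ⟨x, hVU x.2⟩) (x' := x) rfl ?_
    refine eventually_zeroExt_eq (W x) (hVU x.2) x.2 (hxW x) fun y h1 h2 h3 => ?_
    exact (hA x ⟨y, h2⟩ h3 l).symm

theorem CInf.tendsto_of_local (hVU : V ≤ U) {α : Type*} {p : Filter α} (f : α → CInf V ℂ)
    (f₀ : CInf V ℂ)
    (hloc : ∀ x : V, ∃ (g : α → CInf U ℂ) (g₀ : CInf U ℂ) (W : Opens (Rn n)), (x : Rn n) ∈ W ∧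
      Tendsto g p (𝓝 g₀) ∧
      (∀ a y (hy : y ∈ V), y ∈ W → f a ⟨y, hy⟩ = g a ⟨y, hVU hy⟩) ∧
      ∀ y (hy : y ∈ V), y ∈ W → f₀ ⟨y, hy⟩ = g₀ ⟨y, hVU hy⟩) :
    Tendsto f p (𝓝 f₀) := by
  have : LocallyCompactSpace U := U.isOpen.locallyCompactSpace
  rw [CInf.tendsto_iff]
  intro l
  refine ContinuousMap.tendsto_of_tendstoLocallyUniformly ?_
  intro u hu x
  obtain ⟨g, g₀, W, hxW, hg, hfg, hfg₀⟩ := hloc x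
  have h1 := ContinuousMap.tendsto_iff_tendstoLocallyUniformly.1 (CInf.tendsto_iff.1 hg l)
  obtain ⟨t, ht, hev⟩ := h1 u hu ⟨x, hVU x.2⟩
  have hc : Continuous fun y : V => (⟨y, hVU y.2⟩ : U) := by fun_prop
  refine ⟨(fun y : V => (⟨y, hVU y.2⟩ : U)) ⁻¹' t ∩ (fun y : V => (y : Rn n)) ⁻¹' W,
    inter_mem (hc.continuousAt.preimage_mem_nhds ht)
      ((W.isOpen.preimage continuous_subtype_val).mem_nhds hxW), ?_⟩
  filter_upwards [hev] with a ha y hy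
  have e1 : (f a).iterPartial l y = (g a).iterPartial l ⟨y, hVU y.2⟩ :=
    (f a).iterPartial_germ (g a) W y.2 (hVU y.2) hy.2 (fun z h1 _ h3 => hfg a z h1 h3) l
  have e2 : f₀.iterPartial l y = g₀.iterPartial l ⟨y, hVU y.2⟩ :=
    f₀.iterPartial_germ g₀ W y.2 (hVU y.2) hy.2 (fun z h1 _ h3 => hfg₀ z h1 h3) l
  rw [e1, e2]
  exact ha _ hy.1

theorem isSmoothCurve_of_local (hVU : V ≤ U) (c : ℝ → CInf V ℂ)
    (hloc : ∀ x : V, ∃ (C : ℝ → CInf U ℂ) (W : Opens (Rn n)), (x : Rn n) ∈ W ∧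
      IsSmoothCurve C ∧ ∀ t y (hy : y ∈ V), y ∈ W → c t ⟨y, hy⟩ = C t ⟨y, hVU hy⟩) :
    IsSmoothCurve c := by
  choose C W hxW hC hcC using hloc
  choose D hD0 hD using hC
  have hev : ∀ (x : V) k t (y : U), HasCurveDerivAt (fun s => D x k s y) (D x (k + 1) t y) t :=
    fun x k t y => (hD x k t).map
      (⟨⟨fun f : CInf U ℂ => f y, fun _ _ => rfl⟩, fun _ _ => rfl⟩ : CInf U ℂ →ₗ[ℝ] ℂ)
      (CInf.continuous_eval y)
  have hA : ∀ (x y : V), (y : Rn n) ∈ W x → ∀ k t,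
      D y k t ⟨y, hVU y.2⟩ = D x k t ⟨y, hVU y.2⟩ := by
    intro x y hy k
    induction k with
    | zero =>
      intro t
      rw [hD0, hD0, ← hcC y t y y.2 (hxW y), ← hcC x t y y.2 hy]
    | succ k ih =>
      intro t
      have h1 := hev y k t ⟨y, hVU y.2⟩
      have h2 := hev x k t ⟨y, hVU y.2⟩
      rw [funext ih] at h1
      exact h1.unique h2
  have hsm : ∀ k t, IsSmooth fun y : V => D y k t ⟨y, hVU y.2⟩ := fun k t =>
    isSmooth_of_local hVU _ fun x => ⟨D x k t, W x, hxW x, fun y hy hyW => hA x ⟨y, hy⟩ hyW k t⟩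
  refine ⟨fun k t => CInf.mk _ (hsm k t), ?_, fun k t => ?_⟩
  · funext t
    ext x
    rw [CInf.mk_apply, hD0, ← hcC x t x x.2 (hxW x)]
  · refine CInf.tendsto_of_local hVU _ _ fun x =>
      ⟨fun h => h⁻¹ • (D x k (t + h) - D x k t), D x (k + 1) t, W x, hxW x, hD x k t, ?_, ?_⟩
    · intro h y hy hyW
      simp only [CInf.real_smul_apply, CInf.sub_apply, CInf.mk_apply]
      rw [hA x ⟨y, hy⟩ hyW, hA x ⟨y, hy⟩ hyW]
    · intro y hy hyW
      exact hA x ⟨y, hy⟩ hyW _ _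

/-! ### Multiplication by a cut-off function, followed by extension by zero -/

/-- `ρ` is a smooth function on `ℝⁿ` with support contained in `V`. -/
structure IsCutoff (V : Opens (Rn n)) (ρ : Rn n → ℝ) : Prop where
  smooth : ContDiff ℝ ∞ ρ
  supp : tsupport ρ ⊆ V

/-- The `i`-th partial derivative of a scalar function. -/
def scalarPartial (i : Fin n) (ρ : Rn n → ℝ) (x : Rn n) : ℝ := fderiv ℝ ρ x (stdVec i)

theorem IsCutoff.partial {ρ : Rn n → ℝ} (h : IsCutoff V ρ) (i : Fin n) :
    IsCutoff V (scalarPartial i ρ) := by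
  refine ⟨(h.smooth.fderiv_right (m := ∞) (by simp)).clm_apply contDiff_const, ?_⟩
  refine Subset.trans (closure_mono ?_) ((tsupport_fderiv_subset ℝ (f := ρ)).trans h.supp)
  intro x hx h0
  exact hx (by simp only [scalarPartial]; rw [h0]; rfl)

theorem IsCutoff.tendsto {ρ : Rn n → ℝ} (h : IsCutoff V ρ) (i : Fin n) (x : Rn n) :
    Tendsto (fun t : ℝ => t⁻¹ * (ρ (x + t • stdVec i) - ρ x)) (𝓝[≠] 0)
      (𝓝 (scalarPartial i ρ x)) := by
  have h1 : HasLineDerivAt ℝ ρ (scalarPartial i ρ x) x (stdVec i) :=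
    ((h.smooth.differentiable (by simp)) x).hasFDerivAt.hasLineDerivAt _
  have h2 := hasDerivAt_iff_tendsto_slope_zero.1 h1
  simpa using h2

/-- `x ↦ ρ x • L (f x)`, extended by zero. -/
def cutExtFun (U : Opens (Rn n)) (ρ : Rn n → ℝ) (L : F →L[ℂ] F') (f : V → F) : U → F' :=
  fun x => ρ x • L (zeroExt f (x : Rn n))

theorem hasPartialDerivAt_cutExtFun [ContinuousSMul ℝ F'] {ρ : Rn n → ℝ} (hρ : IsCutoff V ρ)
    (L : F →L[ℂ] F') (f : V → F) (i : Fin n) (g : V → F)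
    (hf : ∀ x, HasPartialDerivAt f i (g x) x) (x : U) :
    HasPartialDerivAt (cutExtFun U ρ L f) i
      (cutExtFun U (scalarPartial i ρ) L f x + cutExtFun U ρ L g x) x := by
  have hline := tendsto_line (x : Rn n) i
  have hUev := hline.eventually (U.isOpen.mem_nhds x.2)
  by_cases hx : (x : Rn n) ∈ V
  · have h1 := (hρ.tendsto i x).smul_const (L (zeroExt f (x : Rn n)))
    have h2 : Tendsto (fun t : ℝ => ρ ((x : Rn n) + t • stdVec i)) (𝓝[≠] 0) (𝓝 (ρ x)) :=
      (hρ.smooth.continuous.tendsto _).comp hline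
    have h3 := h2.smul ((L.continuous.tendsto _).comp (hf ⟨x, hx⟩))
    have h4 := h1.add h3
    unfold HasPartialDerivAt cutExtFun
    rw [zeroExt_of_mem g hx]
    refine h4.congr' ?_
    filter_upwards [hUev] with t ht
    rw [zeroExt_of_mem _ ht]
    have e : f ⟨x, hx⟩ = zeroExt f (x : Rn n) := (zeroExt_of_mem f hx).symm
    simp only [Function.comp_apply, e]
    rw [L.map_smul_of_tower, map_sub, mul_smul, ← smul_comm t⁻¹, ← smul_add, sub_smul, smul_sub]
    congr 1
    abel
  · have hxs : (x : Rn n) ∉ tsupport ρ := fun h => hx (hρ.supp h)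
    have hxs' : (x : Rn n) ∉ tsupport (scalarPartial i ρ) := fun h => hx ((hρ.partial i).supp h)
    unfold HasPartialDerivAt cutExtFun
    rw [image_eq_zero_of_notMem_tsupport hxs, image_eq_zero_of_notMem_tsupport hxs']
    simp only [zero_smul, add_zero, sub_zero]
    refine tendsto_const_nhds.congr' ?_
    filter_upwards [hUev, hline.eventually ((isClosed_tsupport ρ).isOpen_compl.mem_nhds hxs)]
      with t ht hts
    rw [zeroExt_of_mem _ ht]
    simp only
    rw [image_eq_zero_of_notMem_tsupport hts, zero_smul, smul_zero]

theorem continuous_cutExtFun_uncurry [ContinuousSMul ℝ F'] {ρ : Rn n → ℝ} (hρ : IsCutoff V ρ)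
    (L : F →L[ℂ] F') : Continuous fun p : CInf V F × U => cutExtFun U ρ L p.1 p.2 := by
  have : LocallyCompactSpace V := V.isOpen.locallyCompactSpace
  rw [continuous_iff_continuousAt]
  rintro ⟨f, x⟩
  by_cases hx : (x : Rn n) ∈ V
  · have hopen : IsOpen {p : CInf V F × U | (p.2 : Rn n) ∈ V} :=
      V.isOpen.preimage (continuous_subtype_val.comp continuous_snd)
    refine ContinuousOn.continuousAt (s := {p : CInf V F × U | (p.2 : Rn n) ∈ V}) ?_
      (hopen.mem_nhds hx)
    rw [continuousOn_iff_continuous_domRestrict]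
    have e : ({p : CInf V F × U | (p.2 : Rn n) ∈ V}.domRestrict
        fun p : CInf V F × U => cutExtFun U ρ L p.1 p.2) =
        fun p => ρ p.1.2 • L (p.1.1.iterPartial [] ⟨p.1.2, p.2⟩) := by
      funext p
      simp only [domRestrict_apply, cutExtFun]
      rw [zeroExt_of_mem _ p.2, CInf.iterPartial_nil]
    rw [e]
    have hc1 : Continuous fun p : {p : CInf V F × U | (p.2 : Rn n) ∈ V} =>
        (p.1.1.iterPartial [] : C(V, F)) :=
      (CInf.continuous_iterPartial []).comp (continuous_fst.comp continuous_subtype_val)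
    have hc2 : Continuous fun p : {p : CInf V F × U | (p.2 : Rn n) ∈ V} =>
        (⟨p.1.2, p.2⟩ : V) := by fun_prop
    have hc3 : Continuous fun p : {p : CInf V F × U | (p.2 : Rn n) ∈ V} => ρ p.1.2 :=
      hρ.smooth.continuous.comp (by fun_prop)
    exact hc3.smul (L.continuous.comp (hc1.eval hc2))
  · have hxs : (x : Rn n) ∉ tsupport ρ := fun h => hx (hρ.supp h)
    refine continuousAt_const (y := (0 : F')).congr ?_
    have hopen : IsOpen {p : CInf V F × U | (p.2 : Rn n) ∈ (tsupport ρ)ᶜ} :=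
      (isClosed_tsupport ρ).isOpen_compl.preimage (continuous_subtype_val.comp continuous_snd)
    filter_upwards [hopen.mem_nhds hxs] with p hp
    simp only [cutExtFun]
    rw [image_eq_zero_of_notMem_tsupport hp, zero_smul]

theorem cutExtFun_add {ρ : Rn n → ℝ} (L : F →L[ℂ] F') (f g : V → F) :
    cutExtFun U ρ L (f + g) = cutExtFun U ρ L f + cutExtFun U ρ L g := by
  funext x
  by_cases hx : (x : Rn n) ∈ V
  · simp [cutExtFun, zeroExt_of_mem _ hx]
  · simp [cutExtFun, zeroExt_of_notMem _ hx]

/-- The partial derivative of a smooth map, as a smooth map. -/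
def CInf.pderiv [T2Space F] (i : Fin n) (f : CInf U F) : CInf U F :=
  ⟨fun x => f.iterPartial [i] x, fun l x => f.iterPartial (l ++ [i]) x, rfl,
    fun l => (f.iterPartial (l ++ [i])).continuous, fun l j x => f.isDerivSystem.deriv (l ++ [i]) j x⟩

theorem CInf.iterPartial_pderiv [T2Space F] (i : Fin n) (f : CInf U F) (l : List (Fin n)) :
    (f.pderiv i).iterPartial l = f.iterPartial (l ++ [i]) :=
  ContinuousMap.ext fun x => CInf.iterPartial_eq (f := f.pderiv i)
    (D := fun l x => f.iterPartial (l ++ [i]) x)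
    ⟨rfl, fun l => (f.iterPartial (l ++ [i])).continuous,
      fun l j x => f.isDerivSystem.deriv (l ++ [i]) j x⟩ l x

theorem CInf.continuous_pderiv [T2Space F] (i : Fin n) :
    Continuous fun f : CInf U F => f.pderiv i :=
  CInf.continuous_iff.2 fun l => by
    simp only [CInf.iterPartial_pderiv]
    exact CInf.continuous_iterPartial _

theorem CInf.hasPartialDerivAt_pderiv [T2Space F] (i : Fin n) (f : CInf U F) (x : U) :
    HasPartialDerivAt f i (f.pderiv i x) x := by
  have := f.isDerivSystem.deriv [] i x
  rwa [f.isDerivSystem.nil] at this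

theorem CInf.pderiv_eq [T2Space F] {i : Fin n} {f g : CInf U F}
    (h : ∀ x, HasPartialDerivAt f i (g x) x) : f.pderiv i = g :=
  CInf.ext fun x => (f.hasPartialDerivAt_pderiv i x).unique (h x)

theorem isSmooth_cutExtFun [T2Space F] [ContinuousSMul ℝ F'] {ρ : Rn n → ℝ} (hρ : IsCutoff V ρ)
    (L : F →L[ℂ] F') (f : CInf V F) : IsSmooth (cutExtFun U ρ L f) := by
  let B : Set (U → F') := {g | ∃ (ρ : Rn n → ℝ) (f : CInf V F), IsCutoff V ρ ∧
    g = cutExtFun U ρ L f}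
  refine isSmooth_of_closed (AddSubmonoid.closure B : Set (U → F')) ?_ _
    (AddSubmonoid.subset_closure ⟨ρ, f, hρ, rfl⟩)
  intro g hg
  induction hg using AddSubmonoid.closure_induction with
  | mem g hg =>
    obtain ⟨ρ, f, hρ, rfl⟩ := hg
    refine ⟨(continuous_cutExtFun_uncurry hρ L).comp (Continuous.prodMk_right f), fun i => ?_⟩
    refine ⟨cutExtFun U (scalarPartial i ρ) L f + cutExtFun U ρ L (f.pderiv i),
      add_mem (AddSubmonoid.subset_closure ⟨_, f, hρ.partial i, rfl⟩)
        (AddSubmonoid.subset_closure ⟨ρ, f.pderiv i, hρ, rfl⟩), fun x => ?_⟩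
    exact hasPartialDerivAt_cutExtFun hρ L f i _ (f.hasPartialDerivAt_pderiv i) x
  | zero => exact ⟨continuous_zero, fun i => ⟨0, zero_mem _,
      fun x => isDerivSystem_zero.deriv [] i x⟩⟩
  | add g g' _ _ h h' =>
    refine ⟨h.1.add h'.1, fun i => ?_⟩
    obtain ⟨a, ha, ha'⟩ := h.2 i
    obtain ⟨b, hb, hb'⟩ := h'.2 i
    exact ⟨a + b, add_mem ha hb, fun x => (ha' x).add (hb' x)⟩

/-- `f ↦ (x ↦ ρ x • L (f x))`, extended by zero, as a map `C^∞(V, F) → C^∞(U, F')`. -/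
def cutExt [T2Space F] [ContinuousSMul ℝ F'] (U : Opens (Rn n)) {ρ : Rn n → ℝ}
    (hρ : IsCutoff V ρ) (L : F →L[ℂ] F') (f : CInf V F) : CInf U F' :=
  CInf.mk _ (isSmooth_cutExtFun hρ L f)

theorem continuous_cutExt [T2Space F] [T2Space F'] [ContinuousSMul ℝ F'] {ρ : Rn n → ℝ}
    (hρ : IsCutoff V ρ) (L : F →L[ℂ] F') : Continuous (cutExt U hρ L) := by
  rw [CInf.continuous_iff]
  intro l
  induction l using List.reverseRecOn generalizing ρ with
  | nil =>
    refine ContinuousMap.continuous_of_continuous_uncurry _ ?_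
    refine (continuous_cutExtFun_uncurry (U := U) hρ L).congr fun p => ?_
    exact (CInf.iterPartial_nil (cutExt U hρ L p.1) p.2).symm
  | append_singleton l i ih =>
    have e : ∀ f : CInf V F, (cutExt U hρ L f).iterPartial (l ++ [i]) =
        (cutExt U (hρ.partial i) L f).iterPartial l +
          (cutExt U hρ L (f.pderiv i)).iterPartial l := by
      intro f
      rw [← CInf.iterPartial_pderiv, ← CInf.iterPartial_add]
      congr 1
      exact CInf.pderiv_eq fun x =>
        hasPartialDerivAt_cutExtFun hρ L f i _ (f.hasPartialDerivAt_pderiv i) x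
    simp only [e]
    exact (ih (hρ.partial i)).add ((ih hρ).comp (CInf.continuous_pderiv i))

theorem isSmoothCurve_cutExt [T2Space F] [T2Space F'] [ContinuousSMul ℝ F'] {ρ : Rn n → ℝ}
    (hρ : IsCutoff V ρ) (L : F →L[ℂ] F') {c : ℝ → CInf V F} (hc : IsSmoothCurve c) :
    IsSmoothCurve fun t => cutExt U hρ L (c t) := by
  refine hc.map (⟨⟨cutExt U hρ L, fun f g => ?_⟩, fun r f => ?_⟩ :
    CInf V F →ₗ[ℝ] CInf U F') (continuous_cutExt hρ L)
  · exact CInf.ext fun x => congrFun (cutExtFun_add L f g) x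
  · refine CInf.ext fun x => ?_
    show cutExtFun U ρ L (r • f) x = r • cutExtFun U ρ L f x
    by_cases hx : (x : Rn n) ∈ V
    · simp only [cutExtFun, zeroExt_of_mem _ hx]
      rw [CInf.real_smul_apply, L.map_smul_of_tower, smul_comm]
    · simp [cutExtFun, zeroExt_of_notMem _ hx]

theorem exists_cutoff (V : Opens (Rn n)) {x : Rn n} (hx : x ∈ V) :
    ∃ (ρ : Rn n → ℝ) (W : Opens (Rn n)), IsCutoff V ρ ∧ x ∈ W ∧ closure (W : Set (Rn n)) ⊆ V ∧
      ∀ y ∈ W, ρ y = 1 := by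
  obtain ⟨δ, hδ, hδV⟩ := Metric.nhds_basis_closedBall.mem_iff.1 (V.isOpen.mem_nhds hx)
  let b : ContDiffBump x := ⟨δ / 2, δ, by positivity, by linarith⟩
  refine ⟨b, ⟨Metric.ball x (δ / 2), Metric.isOpen_ball⟩, ⟨b.contDiff, ?_⟩,
    Metric.mem_ball_self (by positivity), ?_, fun y hy => ?_⟩
  · rw [b.tsupport_eq]; exact hδV
  · refine Metric.closure_ball_subset_closedBall.trans
      (Subset.trans (Metric.closedBall_subset_closedBall ?_) hδV)
    linarith
  · exact b.one_of_mem_closedBall (Metric.ball_subset_closedBall hy)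

end Local

/-! ### Test functions, distributions, smoothing kernels -/

section Basic

variable {n : ℕ}

instance (U : Opens (Rn n)) : ContinuousConstSMul ℂ 𝓓(U, ℂ) :=
  ⟨fun c => by
    have h := (TestFunction.postcompCLM (Ω := U) (n := ⊤) (c • ContinuousLinearMap.id ℂ ℂ)).continuous
    refine h.congr fun f => ?_
    ext x
    rfl⟩

/-- The space `𝓓'(U)` of (complex) distributions on `U`. -/
abbrev Dist (U : Opens (Rn n)) := 𝓓(U, ℂ) →L[ℂ] ℂ

/-- Restriction `u ↦ u|_V` of distributions to an open subset `V` of `U`. -/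
def Dist.restrict {U : Opens (Rn n)} (u : Dist U) (V : Opens (Rn n)) (_hVU : V ≤ U) : Dist V :=
  u.comp (TestFunction.monoCLM ℂ : 𝓓(V, ℂ) →L[ℂ] 𝓓(U, ℂ))

/-- The support of a distribution `u` on `U`, as a subset of `U`. Mathlib's `dsupport` is the
intersection of all closed sets of `ℝⁿ` off which `u` vanishes, so it may also contain boundary
points of `U`, which are discarded here. -/
def Dist.supp {U : Opens (Rn n)} (u : Dist U) : Set (Rn n) :=
  (U : Set (Rn n)) ∩ Distribution.dsupport u

/-- The space `SK(U) = C^∞(U, 𝓓(U))` of smoothing kernels on `U`. -/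
abbrev SK (U : Opens (Rn n)) := CInf U 𝓓(U, ℂ)

/-! ### The basic space and its local elements -/

/-- The basic space `ℰ(U) = C^∞(SK(U), C^∞(U))`. -/
def basicSpace (U : Opens (Rn n)) : Submodule ℂ (SK U → CInf U ℂ) where
  carrier := {R | IsConvenientlySmooth R}
  add_mem' hR hS c hc := (hR c hc).add (hS c hc)
  zero_mem' _ _ := isSmoothCurve_const 0
  smul_mem' a _ hR c hc := (hR c hc).map
    ((LinearMap.lsmul ℂ (CInf U ℂ) a).restrictScalars ℝ) (continuous_const_smul a)

/-- `R` is local: `φ|_W = ψ|_W` implies `R(φ)|_W = R(ψ)|_W` for `W ⊆ U` open. -/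
def IsLocal {U : Opens (Rn n)} (R : SK U → CInf U ℂ) : Prop :=
  ∀ (W : Opens (Rn n)) (_ : W ≤ U) (φ ψ : SK U), (∀ x : U, (x : Rn n) ∈ W → φ x = ψ x) →
    ∀ x : U, (x : Rn n) ∈ W → R φ x = R ψ x

/-- The space `ℰ_loc(U)` of local elements of the basic space. -/
def ELoc (U : Opens (Rn n)) : Submodule ℂ (SK U → CInf U ℂ) where
  carrier := {R | R ∈ basicSpace U ∧ IsLocal R}
  add_mem' hR hS := ⟨add_mem hR.1 hS.1, fun W hW φ ψ h x hx =>
    congrArg₂ (· + ·) (hR.2 W hW φ ψ h x hx) (hS.2 W hW φ ψ h x hx)⟩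
  zero_mem' := ⟨zero_mem _, fun _ _ _ _ _ _ _ => rfl⟩
  smul_mem' a _ hR := ⟨Submodule.smul_mem _ a hR.1, fun W hW φ ψ h x hx =>
    congrArg (a • ·) (hR.2 W hW φ ψ h x hx)⟩

/-- The smooth function `⟨u, φ⟩ : x ↦ ⟨u, φ(x)⟩`. -/
def pairing {U : Opens (Rn n)} (u : Dist U) (φ : SK U) : CInf U ℂ :=
  CInf.mk (fun x => u (φ x))
    ⟨_, φ.isDerivSystem.map (u.toLinearMap.restrictScalars ℝ) u.continuous⟩

@[simp] theorem pairing_apply {U : Opens (Rn n)} (u : Dist U) (φ : SK U) (x : U) :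
    pairing u φ x = u (φ x) := rfl

theorem iterPartial_pairing {U : Opens (Rn n)} (u : Dist U) (φ : SK U) (l : List (Fin n)) :
    (pairing u φ).iterPartial l = (⟨u, u.continuous⟩ : C(𝓓(U, ℂ), ℂ)).comp (φ.iterPartial l) :=
  ContinuousMap.ext fun x => CInf.iterPartial_eq (f := pairing u φ)
    (φ.isDerivSystem.map (u.toLinearMap.restrictScalars ℝ) u.continuous) l x

theorem continuous_pairing {U : Opens (Rn n)} (u : Dist U) : Continuous (pairing u) :=
  CInf.continuous_iff.2 fun l => by
    simp only [iterPartial_pairing]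
    exact (ContinuousMap.continuous_postcomp _).comp (CInf.continuous_iterPartial l)

/-- The embedding `ι : 𝓓'(U) → ℰ_loc(U)`, `(ι u)(φ) = ⟨u, φ⟩`. -/
def iota (U : Opens (Rn n)) : Dist U →ₗ[ℂ] ELoc U where
  toFun u := ⟨pairing u, by
    refine ⟨fun c hc => ?_, fun W _ φ ψ h x hx => by simp [h x hx]⟩
    exact hc.map (⟨⟨pairing u, fun φ ψ => CInf.ext fun x => u.map_add _ _⟩,
      fun r φ => CInf.ext fun x => u.map_smul_of_tower r _⟩ : SK U →ₗ[ℝ] CInf U ℂ)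
      (continuous_pairing u)⟩
  map_add' _ _ := rfl
  map_smul' _ _ := rfl

/-! ### Restriction of local elements -/

/-- `φ|_W = ψ|_W` for smoothing kernels `φ` on `V` and `ψ` on `U`, where `W ⊆ V ⊆ U`, regarding
`𝓓(V)` as a subspace of `𝓓(U)`. -/
def SK.EqOn {U V : Opens (Rn n)} (φ : SK V) (ψ : SK U) (W : Opens (Rn n)) : Prop :=
  ∀ (x : Rn n) (hV : x ∈ V) (hU : x ∈ U), x ∈ W →
    (φ ⟨x, hV⟩ : Rn n → ℂ) = (ψ ⟨x, hU⟩ : Rn n → ℂ)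

/-- The property characterizing `S = R|_V`: for any open `W` with `closure W ⊆ V`, `φ ∈ SK(V)` and
`ψ ∈ SK(U)` with `φ|_W = ψ|_W` we have `S(φ)|_W = R(ψ)|_W`. -/
def IsRestriction {U V : Opens (Rn n)} (R : ELoc U) (S : ELoc V) : Prop :=
  ∀ W : Opens (Rn n), closure (W : Set (Rn n)) ⊆ V → ∀ (φ : SK V) (ψ : SK U), SK.EqOn φ ψ W →
    ∀ (x : Rn n) (hV : x ∈ V) (hU : x ∈ U), x ∈ W → S.1 φ ⟨x, hV⟩ = R.1 ψ ⟨x, hU⟩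

/-- A smoothing kernel on `V` multiplied with a cut-off function and extended by zero to `U`. -/
def SK.cutExt {V : Opens (Rn n)} (U : Opens (Rn n)) {ρ : Rn n → ℝ} (hρ : IsCutoff V ρ) (φ : SK V) :
    SK U :=
  Colombeau.cutExt U hρ (TestFunction.monoCLM ℂ) φ

theorem SK.cutExt_apply {U V : Opens (Rn n)} (hVU : V ≤ U) {ρ : Rn n → ℝ} (hρ : IsCutoff V ρ)
    (φ : SK V) {x : Rn n} (hV : x ∈ V) (hU : x ∈ U) (y : Rn n) :
    SK.cutExt U hρ φ ⟨x, hU⟩ y = ρ x • φ ⟨x, hV⟩ y := by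
  change (ρ x • (TestFunction.monoCLM ℂ (zeroExt φ x) : 𝓓(U, ℂ))) y = _
  rw [zeroExt_of_mem _ hV]
  change ρ x • ((TestFunction.monoCLM ℂ (φ ⟨x, hV⟩) : 𝓓(U, ℂ)) : Rn n → ℂ) y = _
  rw [TestFunction.monoCLM_apply, if_pos ⟨le_rfl, hVU⟩]

theorem SK.cutExt_apply_of_notMem {U V : Opens (Rn n)} {ρ : Rn n → ℝ}
    (hρ : IsCutoff V ρ) (φ : SK V) {x : Rn n} (hV : x ∉ tsupport ρ) (hU : x ∈ U) :
    SK.cutExt U hρ φ ⟨x, hU⟩ = 0 := by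
  change ρ x • (TestFunction.monoCLM ℂ (zeroExt φ x) : 𝓓(U, ℂ)) = _
  rw [image_eq_zero_of_notMem_tsupport hV, zero_smul]

theorem SK.eqOn_cutExt {U V : Opens (Rn n)} (hVU : V ≤ U) {ρ : Rn n → ℝ} (hρ : IsCutoff V ρ)
    (φ : SK V) {W : Opens (Rn n)} (hW : ∀ y ∈ W, ρ y = 1) : SK.EqOn φ (SK.cutExt U hρ φ) W := by
  intro x hV hU hx
  funext y
  rw [SK.cutExt_apply hVU hρ φ hV hU, hW x hx, one_smul]

theorem IsRestriction.unique {U V : Opens (Rn n)} (hVU : V ≤ U) {R : ELoc U} {S S' : ELoc V}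
    (h : IsRestriction R S) (h' : IsRestriction R S') : S = S' := by
  refine Subtype.ext (funext fun φ => CInf.ext fun x => ?_)
  obtain ⟨ρ, W, hρ, hx, hWV, hW⟩ := exists_cutoff V x.2
  have e := SK.eqOn_cutExt hVU hρ φ hW
  exact (h W hWV φ _ e x x.2 (hVU x.2) hx).trans (h' W hWV φ _ e x x.2 (hVU x.2) hx).symm

/-- Values of a local `R` at `x` depend only on the germ of the kernel at `x`. -/
theorem ELoc.apply_eq {U : Opens (Rn n)} (R : ELoc U) {φ ψ : SK U} (W : Opens (Rn n))
    (h : ∀ x : U, (x : Rn n) ∈ W → φ x = ψ x) (x : U) (hx : (x : Rn n) ∈ W) :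
    R.1 φ x = R.1 ψ x :=
  R.2.2 (W ⊓ U) inf_le_right φ ψ (fun y hy => h y hy.1) x ⟨hx, x.2⟩

theorem SK.EqOn.mono {U V : Opens (Rn n)} {φ : SK V} {ψ : SK U} {W W' : Opens (Rn n)}
    (h : SK.EqOn φ ψ W) (hW : W' ≤ W) : SK.EqOn φ ψ W' :=
  fun x hV hU hx => h x hV hU (hW hx)

theorem SK.EqOn.trans {U V : Opens (Rn n)} {φ φ' : SK V} {ψ ψ' : SK U}
    {W W' : Opens (Rn n)} (h : SK.EqOn φ ψ W) (h' : SK.EqOn φ' ψ' W')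
    (e : ∀ x : V, (x : Rn n) ∈ W ⊓ W' → φ x = φ' x) (x : U) (hx : (x : Rn n) ∈ W ⊓ W' ⊓ V) :
    ψ x = ψ' x := by
  refine TestFunction.ext fun y => ?_
  rw [← h x hx.2 x.2 hx.1.1, ← h' x hx.2 x.2 hx.1.2, e ⟨x, hx.2⟩ hx.1]

theorem existsUnique_isRestriction {U V : Opens (Rn n)} (hVU : V ≤ U) (R : ELoc U) :
    ∃! S : ELoc V, IsRestriction R S := by
  choose ρ W hρ hxW hWV hW using fun x : V => exists_cutoff V x.2
  let f : SK V → V → ℂ := fun φ x => R.1 (SK.cutExt U (hρ x) φ) ⟨x, hVU x.2⟩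
  have hf : ∀ (φ : SK V) (ψ : SK U) (W' : Opens (Rn n)), SK.EqOn φ ψ W' →
      ∀ (x : V), (x : Rn n) ∈ W' → f φ x = R.1 ψ ⟨x, hVU x.2⟩ := fun φ ψ W' h x hx =>
    ELoc.apply_eq R (W x ⊓ W' ⊓ V)
      (fun y hy => (SK.eqOn_cutExt hVU (hρ x) φ (hW x)).trans h (fun _ _ => rfl) y hy)
      ⟨x, hVU x.2⟩ ⟨⟨hxW x, hx⟩, x.2⟩
  have hsm : ∀ φ, IsSmooth (f φ) := fun φ => isSmooth_of_local hVU _ fun x =>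
    ⟨R.1 (SK.cutExt U (hρ x) φ), W x, hxW x, fun y hy hyW =>
      hf φ _ (W x) (SK.eqOn_cutExt hVU (hρ x) φ (hW x)) ⟨y, hy⟩ hyW⟩
  have hS : (fun φ => CInf.mk (f φ) (hsm φ)) ∈ ELoc V := by
    refine ⟨fun c hc => isSmoothCurve_of_local hVU _ fun x =>
      ⟨fun t => R.1 (SK.cutExt U (hρ x) (c t)), W x, hxW x,
        R.2.1 _ (isSmoothCurve_cutExt (hρ x) _ hc), fun t y hy hyW =>
          hf (c t) _ (W x) (SK.eqOn_cutExt hVU (hρ x) (c t) (hW x)) ⟨y, hy⟩ hyW⟩, ?_⟩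
    intro W' _ φ ψ h x hx
    refine ELoc.apply_eq R (W x ⊓ (W x ⊓ W') ⊓ V) (fun y hy => ?_) ⟨x, hVU x.2⟩
      ⟨⟨hxW x, hxW x, hx⟩, x.2⟩
    exact (SK.eqOn_cutExt hVU (hρ x) φ (hW x)).trans
      ((SK.eqOn_cutExt hVU (hρ x) ψ (hW x)).mono inf_le_left) (fun z hz => h z hz.2.2) y hy
  refine ⟨⟨_, hS⟩, fun W' _ φ ψ h x hV hU hx => hf φ ψ W' h ⟨x, hV⟩ hx, fun S' h' => ?_⟩
  exact h'.unique hVU fun W' _ φ ψ h x hV hU hx => hf φ ψ W' h ⟨x, hV⟩ hx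

/-- The restriction `R|_V ∈ ℰ_loc(V)` of `R ∈ ℰ_loc(U)`: the unique element of `ℰ_loc(V)` with the
property `IsRestriction`. -/
def restrictELoc {U V : Opens (Rn n)} (hVU : V ≤ U) (R : ELoc U) : ELoc V :=
  (existsUnique_isRestriction hVU R).choose

theorem isRestriction_restrictELoc {U V : Opens (Rn n)} (hVU : V ≤ U) (R : ELoc U) :
    IsRestriction R (restrictELoc hVU R) :=
  (existsUnique_isRestriction hVU R).choose_spec.1

/-- Restriction is linear. -/
def restrictELocₗ {U V : Opens (Rn n)} (hVU : V ≤ U) : ELoc U →ₗ[ℂ] ELoc V where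
  toFun := restrictELoc hVU
  map_add' R R' := (isRestriction_restrictELoc hVU (R + R')).unique hVU
    fun W hW φ ψ h x hV hU hx => congrArg₂ (· + ·)
      (isRestriction_restrictELoc hVU R W hW φ ψ h x hV hU hx)
      (isRestriction_restrictELoc hVU R' W hW φ ψ h x hV hU hx)
  map_smul' a R := (isRestriction_restrictELoc hVU (a • R)).unique hVU
    fun W hW φ ψ h x hV hU hx => congrArg (a • ·)
      (isRestriction_restrictELoc hVU R W hW φ ψ h x hV hU hx)

/-! ### Localizing sequences and the quotient `Ẽ_loc` -/

section CInfTilde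

variable (U : Opens (Rn n)) (F : Type*) [AddCommGroup F] [Module ℂ F] [Module ℝ F]
  [IsScalarTower ℝ ℂ F] [TopologicalSpace F] [IsTopologicalAddGroup F] [ContinuousConstSMul ℂ F]

/-- Sequences in `C^∞(U, F)` which are locally eventually zero: every point of `U` has an open
neighborhood in `U` on which all but finitely many members of the sequence vanish. -/
def eventuallyZero : Submodule ℂ (ℕ → CInf U F) where
  carrier := {f | ∀ x : U, ∃ W : Opens (Rn n), W ≤ U ∧ (x : Rn n) ∈ W ∧
    ∃ k₀ : ℕ, ∀ k ≥ k₀, ∀ y : U, (y : Rn n) ∈ W → f k y = 0}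
  add_mem' := by
    intro f g hf hg x
    obtain ⟨W, hWU, hxW, k, hk⟩ := hf x
    obtain ⟨W', _, hxW', k', hk'⟩ := hg x
    refine ⟨W ⊓ W', inf_le_left.trans hWU, ⟨hxW, hxW'⟩, max k k', fun j hj y hy => ?_⟩
    rw [Pi.add_apply, CInf.add_apply, hk j (le_of_max_le_left hj) y hy.1,
      hk' j (le_of_max_le_right hj) y hy.2, add_zero]
  zero_mem' x := ⟨U, le_rfl, x.2, 0, fun _ _ _ _ => rfl⟩
  smul_mem' := by
    intro a f hf x
    obtain ⟨W, hWU, hxW, k, hk⟩ := hf x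
    refine ⟨W, hWU, hxW, k, fun j hj y hy => ?_⟩
    rw [Pi.smul_apply, CInf.smul_apply, hk j hj y hy, smul_zero]

/-- The quotient `C̃^∞(U, F)` of the sequences in `C^∞(U, F)` by those locally eventually zero. -/
abbrev CInfTilde := (ℕ → CInf U F) ⧸ eventuallyZero U F

end CInfTilde

/-- A sequence of smoothing kernels is localizing: every point of `U` has an open neighborhood `W`
in `U` such that, for every `r > 0`, for all large `k` and all `y ∈ W` the support of `φ_k(y)` is
contained in the closed ball of radius `r` around `y`. -/
def IsLocalizing {U : Opens (Rn n)} (φ : ℕ → SK U) : Prop :=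
  ∀ x : U, ∃ W : Opens (Rn n), W ≤ U ∧ (x : Rn n) ∈ W ∧ ∀ r > (0 : ℝ), ∃ k₀ : ℕ, ∀ k ≥ k₀,
    ∀ y : U, (y : Rn n) ∈ W → tsupport (φ k y) ⊆ Metric.closedBall (y : Rn n) r

/-- The value `R([(φ_k)_k]) = [(R(φ_k))_k]` of `R ∈ ℰ_loc(U)` on the class of the sequence `φ`. -/
def evalTilde {U : Opens (Rn n)} (φ : ℕ → SK U) : ELoc U →ₗ[ℂ] CInfTilde U ℂ where
  toFun R := Submodule.Quotient.mk fun k => R.1 (φ k)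
  map_add' _ _ := rfl
  map_smul' _ _ := rfl

/-- `𝒩(U)`: the `R ∈ ℰ_loc(U)` with `R([(φ_k)_k]) = 0` in `C̃^∞(U)` for all classes of localizing
sequences. -/
def negligible (U : Opens (Rn n)) : Submodule ℂ (ELoc U) where
  carrier := {R | ∀ φ : ℕ → SK U, IsLocalizing φ → evalTilde φ R = 0}
  add_mem' hR hS φ hφ := by rw [map_add, hR φ hφ, hS φ hφ, add_zero]
  zero_mem' φ _ := map_zero (evalTilde φ)
  smul_mem' a R hR φ hφ := by rw [map_smul, hR φ hφ, smul_zero]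

/-- The quotient `Ẽ_loc(U) = ℰ_loc(U) / 𝒩(U)`. -/
abbrev ETilde (U : Opens (Rn n)) := ELoc U ⧸ negligible U

theorem mem_negligible_iff {U : Opens (Rn n)} {R : ELoc U} : R ∈ negligible U ↔
    ∀ φ : ℕ → SK U, IsLocalizing φ → (fun k => R.1 (φ k)) ∈ eventuallyZero U ℂ :=
  forall₂_congr fun _ _ => Submodule.Quotient.mk_eq_zero _

theorem IsLocalizing.cutExt {U V : Opens (Rn n)} (hVU : V ≤ U) {ρ : Rn n → ℝ} (hρ : IsCutoff V ρ)
    {φ : ℕ → SK V} (h : IsLocalizing φ) : IsLocalizing fun k => SK.cutExt U hρ (φ k) := by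
  intro x
  by_cases hx : (x : Rn n) ∈ V
  · obtain ⟨W, hWV, hxW, hW⟩ := h ⟨x, hx⟩
    refine ⟨W, hWV.trans hVU, hxW, fun r hr => ?_⟩
    obtain ⟨k₀, hk₀⟩ := hW r hr
    refine ⟨k₀, fun k hk y hy => ?_⟩
    have hsub : Function.support (SK.cutExt U hρ (φ k) y) ⊆
        Function.support (φ k ⟨y, hWV hy⟩) := fun z hz hz0 => hz ?_
    · exact (closure_mono hsub).trans (hk₀ k hk ⟨y, hWV hy⟩ hy)
    rw [SK.cutExt_apply hVU hρ (φ k) (hWV hy) y.2, hz0, smul_zero]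
  · refine ⟨⟨(tsupport ρ)ᶜ, (isClosed_tsupport ρ).isOpen_compl⟩ ⊓ U, inf_le_right,
      ⟨fun h' => hx (hρ.supp h'), x.2⟩, fun r hr => ⟨0, fun k _ y hy => ?_⟩⟩
    rw [SK.cutExt_apply_of_notMem hρ (φ k) hy.1 y.2]
    simp

theorem negligible_le_comap {U V : Opens (Rn n)} (hVU : V ≤ U) :
    negligible U ≤ (negligible V).comap (restrictELocₗ hVU) := by
  intro R hR
  rw [Submodule.mem_comap, mem_negligible_iff]
  intro φ hφ x
  obtain ⟨ρ, W, hρ, hxW, hWV, hW⟩ := exists_cutoff V x.2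
  obtain ⟨W', hW'U, hxW', k₀, hk₀⟩ :=
    mem_negligible_iff.1 hR _ (hφ.cutExt hVU hρ) ⟨x, hVU x.2⟩
  refine ⟨W ⊓ W' ⊓ V, inf_le_right, ⟨⟨hxW, hxW'⟩, x.2⟩, k₀, fun k hk y hy => ?_⟩
  exact (isRestriction_restrictELoc hVU R W hWV (φ k) _ (SK.eqOn_cutExt hVU hρ (φ k) hW) y y.2
    (hVU y.2) hy.1.1).trans (hk₀ k hk ⟨y, hVU y.2⟩ hy.1.2)

/-- Restriction on the quotients, `[R]|_V = [R|_V]`. -/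
def ETilde.restrict {U V : Opens (Rn n)} (hVU : V ≤ U) : ETilde U →ₗ[ℂ] ETilde V :=
  (negligible U).mapQ (negligible V) (restrictELocₗ hVU) (negligible_le_comap hVU)

/-- The support of `ξ ∈ Ẽ_loc(U)`: the points of `U` without an open neighborhood `V ⊆ U` on which
`ξ|_V = 0`. -/
def ETilde.supp {U : Opens (Rn n)} (ξ : ETilde U) : Set (Rn n) :=
  {x | x ∈ U ∧ ∀ (V : Opens (Rn n)) (hVU : V ≤ U), x ∈ V → ETilde.restrict hVU ξ ≠ 0}

/-- The embedding `ι̃_U : 𝓓'(U) → Ẽ_loc(U)`, the composition of `ι` with the quotient map. -/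
def iotaTilde (U : Opens (Rn n)) : Dist U →ₗ[ℂ] ETilde U :=
  (negligible U).mkQ ∘ₗ iota U

end Basic

end Colombeau

end

namespace Colombeau

open scoped Topology Distributions ContDiff
open Filter Set TopologicalSpace Distribution

variable {n : ℕ} {U V : Opens (Rn n)}

/-! Everything rests on injectivity, and injectivity splits into a local and a global statement.

Local: suppose `ι u` is negligible, but `u` vanishes on no neighborhood of some `x ∈ U`. Then there
are test functions `f k` supported in `U ∩ B_{1/(k+1)}(x)` with `⟨u, f k⟩ ≠ 0`. The constant kernels
`y ↦ f k` do not localize, since for `y` away from `x` the support of `f k` is not close to `y`.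
Multiplying by a cut-off `ρ k` supported in the same small set and equal to 1 near `x` cures this:
the kernel `y ↦ ρ k y • f k` is zero unless `y` is near `x`, and then the support of `f k` is near
`y`. The sequence is localizing, so for some `k` the function `y ↦ ρ k y * ⟨u, f k⟩` vanishes near
`x`; its value at `x` is `⟨u, f k⟩`, a contradiction. This is
`exists_isVanishingOn_of_iota_mem_negligible`.

Global: a distribution that vanishes near every point of `U` is zero, by compactness of the supports
of test functions (`Dist.eq_zero_of_locally`).

Compatibility with restriction already holds in `ℰ_loc`, before passing to the quotient: `ι (u|_V)`
has the property that characterizes `(ι u)|_V`. The supports then agree because, by injectivity over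
each open `V ⊆ U`, the restriction of `ι̃ u` to `V` is zero exactly when `u` vanishes on `V`. -/

/-! ### Localizing sequences built from test functions -/

theorem isDerivSystem_const {F : Type*} [AddCommGroup F] [Module ℝ F] [TopologicalSpace F]
    (g : F) : IsDerivSystem (fun _ : U => g) (fun l _ => if l = [] then g else 0) := by
  refine ⟨by simp, fun _ => continuous_const, fun l i x => ?_⟩
  unfold HasPartialDerivAt
  refine (tendsto_const_nhds (x := (0 : F))).congr' ?_ |>.trans (by simp)
  filter_upwards [(tendsto_line (x : Rn n) i).eventually (U.isOpen.mem_nhds x.2)] with t ht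
  rw [zeroExt_of_mem _ ht, sub_self, smul_zero]

/-- The smoothing kernel `x ↦ ρ x • f`. -/
noncomputable def SK.smulConst {ρ : Rn n → ℝ} (hρ : IsCutoff U ρ) (f : 𝓓(U, ℂ)) : SK U :=
  Colombeau.cutExt U hρ (ContinuousLinearMap.id ℂ _)
    (CInf.mk (fun _ => f) ⟨_, isDerivSystem_const f⟩)

theorem SK.smulConst_apply {ρ : Rn n → ℝ} (hρ : IsCutoff U ρ) (f : 𝓓(U, ℂ)) (x : U) :
    SK.smulConst hρ f x = ρ x • f := by
  change ρ x • (zeroExt (CInf.mk (fun _ : U => f) ⟨_, isDerivSystem_const f⟩) (x : Rn n)) = _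
  rw [zeroExt_coe]
  rfl

/-- A distribution whose image is negligible vanishes near every point: otherwise there are test
functions `f k` with supports shrinking to the point and `u (f k) ≠ 0`, and multiplying them with
cut-off functions gives a localizing sequence. -/
theorem exists_isVanishingOn_of_iota_mem_negligible {u : Dist U} (hu : iota U u ∈ negligible U)
    {x : Rn n} (hx : x ∈ U) : ∃ V : Opens (Rn n), x ∈ V ∧ IsVanishingOn u (V : Set (Rn n)) := by
  by_contra! hV
  let B : ℕ → Opens (Rn n) := fun k =>
    ⟨Metric.ball x (1 / ((k : ℝ) + 1)), Metric.isOpen_ball⟩ ⊓ U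
  have hxB : ∀ k, x ∈ B k := fun k => ⟨Metric.mem_ball_self (by positivity), hx⟩
  choose f hfB hf using fun k => not_isVanishingOn_iff.1 (hV (B k) (hxB k))
  choose ρ W hρ hxW _ hW using fun k => exists_cutoff (B k) (hxB k)
  have hρU : ∀ k, IsCutoff U (ρ k) := fun k =>
    ⟨(hρ k).smooth, (hρ k).supp.trans inf_le_right⟩
  have hloc : IsLocalizing fun k => SK.smulConst (hρU k) (f k) := by
    -- All of `U` serves as the neighborhood, as the estimate is uniform in `y`. Where `ρ k` is
    -- supported, `y` and the points of the support of `f k` both lie within `1 / (k + 1) < r / 2`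
    -- of `x`, hence within `r` of each other; elsewhere the kernel has the value 0.
    refine fun z => ⟨U, le_rfl, z.2, fun r hr => ?_⟩
    obtain ⟨k₀, hk₀⟩ := exists_nat_one_div_lt (half_pos hr)
    refine ⟨k₀, fun k hk y _ => ?_⟩
    have hkr : 1 / ((k : ℝ) + 1) < r / 2 := (Nat.one_div_le_one_div hk).trans_lt hk₀
    rw [SK.smulConst_apply]
    by_cases hy : (y : Rn n) ∈ tsupport (ρ k)
    · have hyB : dist (y : Rn n) x < 1 / ((k : ℝ) + 1) := ((hρ k).supp hy).1
      refine (tsupport_smul_subset_right (fun _ => ρ k y) (f k)).trans fun z hz => ?_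
      have hzB : dist z x < 1 / ((k : ℝ) + 1) := (hfB k hz).1
      have := dist_triangle_right z y x
      exact Metric.mem_closedBall.2 (by linarith)
    · rw [image_eq_zero_of_notMem_tsupport hy, zero_smul]
      simp
  -- A single index `k` and the single point `x` give the contradiction: there `ρ k x = 1`, so the
  -- kernel has the value `f k`.
  obtain ⟨O, -, hxO, k, hk⟩ := mem_negligible_iff.1 hu _ hloc ⟨x, hx⟩
  refine hf k ?_
  have h0 : u (SK.smulConst (hρU k) (f k) ⟨x, hx⟩) = 0 := hk k le_rfl ⟨x, hx⟩ hxO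
  rwa [SK.smulConst_apply, hW k x (hxW k), one_smul] at h0

/-! ### From local vanishing to injectivity -/

/-- The product of a test function with a smooth function. -/
noncomputable def smulTest (h : Rn n → ℝ) (hh : ContDiff ℝ ∞ h) (f : 𝓓(U, ℂ)) : 𝓓(U, ℂ) where
  toFun x := h x • f x
  contDiff' := hh.smul f.contDiff
  hasCompactSupport' :=
    f.hasCompactSupport.mono' ((Function.support_smul_subset_right h f).trans subset_closure)
  tsupport_subset' := (tsupport_smul_subset_right h f).trans f.tsupport_subset

@[simp] theorem smulTest_apply (h : Rn n → ℝ) (hh : ContDiff ℝ ∞ h) (f : 𝓓(U, ℂ)) (x : Rn n) :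
    smulTest h hh f x = h x • f x := rfl

/-- A distribution which vanishes near every point of `U` is zero. -/
theorem Dist.eq_zero_of_locally {u : Dist U}
    (hu : ∀ x ∈ U, ∃ V : Opens (Rn n), x ∈ V ∧ IsVanishingOn u (V : Set (Rn n))) : u = 0 := by
  ext f
  -- This takes the place of a partition of unity. Multiplication by `h` does not change `u`,
  -- although `h` is zero on the support of `f`; applied to `f` itself it gives `u f = u (h • f) = u
  -- 0`. Compactness reduces the construction to small pieces of the support, and `h` becomes a
  -- finite product of factors `1 - ρ`.
  have key : ∃ (h : Rn n → ℝ) (hh : ContDiff ℝ ∞ h), (∀ x ∈ tsupport f, h x = 0) ∧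
      ∀ g : 𝓓(U, ℂ), u (smulTest h hh g) = u g := by
    refine f.hasCompactSupport.isCompact.induction_on
      (p := fun K => ∃ (h : Rn n → ℝ) (hh : ContDiff ℝ ∞ h), (∀ x ∈ K, h x = 0) ∧
        ∀ g : 𝓓(U, ℂ), u (smulTest h hh g) = u g) ?_ ?_ ?_ ?_
    · refine ⟨fun _ => 1, contDiff_const, by simp, fun g => congrArg u ?_⟩
      ext x
      simp
    · rintro s t hst ⟨h, hh, h0, hg⟩
      exact ⟨h, hh, fun x hx => h0 x (hst hx), hg⟩
    · rintro s t ⟨h, hh, h0, hg⟩ ⟨h', hh', h0', hg'⟩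
      -- The product vanishes where either factor does, and the two factors can be removed under `u`
      -- one after the other.
      refine ⟨fun x => h x * h' x, hh.mul hh', ?_, fun g => ?_⟩
      · rintro x (hx | hx)
        · simp [h0 x hx]
        · simp [h0' x hx]
      · rw [← hg' g, ← hg (smulTest h' hh' g)]
        congr 1
        ext x
        simp [mul_assoc]
    · intro x hx
      obtain ⟨V, hxV, hV⟩ := hu x (f.tsupport_subset hx)
      obtain ⟨ρ, W, hρ, hxW, -, hW⟩ := exists_cutoff V hxV
      -- The factor `1 - ρ` vanishes on `W`, where `ρ = 1`, and `u` does not notice it: `ρ • g` is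
      -- supported in `V`, where `u` vanishes.
      refine ⟨W, mem_nhdsWithin_of_mem_nhds (W.isOpen.mem_nhds hxW), fun x => 1 - ρ x,
        contDiff_const.sub hρ.smooth, fun y hy => by simp [hW y hy], fun g => ?_⟩
      have h0 : u (smulTest ρ hρ.smooth g) = 0 :=
        hV _ ((tsupport_smul_subset_left ρ g).trans hρ.supp)
      rw [← sub_zero (u g), ← h0, ← map_sub]
      congr 1
      ext y
      simp [sub_mul]
  obtain ⟨h, hh, h0, hg⟩ := key
  rw [← hg f, show smulTest h hh f = 0 from ?_, map_zero, zero_apply]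
  ext x
  by_cases hx : x ∈ tsupport f
  · simp [h0 x hx]
  · simp [image_eq_zero_of_notMem_tsupport hx]

theorem iotaTilde_injective (U : Opens (Rn n)) : Function.Injective (iotaTilde U) := by
  rw [injective_iff_map_eq_zero]
  intro u hu
  exact Dist.eq_zero_of_locally fun x hx => exists_isVanishingOn_of_iota_mem_negligible
    ((Submodule.Quotient.mk_eq_zero _).1 hu) hx

/-! ### Restriction and supports -/

/-- Both sides evaluate `u` at the same element of `𝓓(U)`: pairing `u|_V` with `φ x` means extending
`φ x` by zero to `U`, and over `W` this extension is `ψ x`. -/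
theorem isRestriction_iota (hVU : V ≤ U) (u : Dist U) :
    IsRestriction (iota U u) (iota V (u.restrict V hVU)) := by
  intro W _ φ ψ h x hV hU hx
  change u (TestFunction.monoCLM ℂ (φ ⟨x, hV⟩)) = u (ψ ⟨x, hU⟩)
  congr 1
  ext y
  rw [TestFunction.monoCLM_apply, if_pos ⟨le_rfl, hVU⟩, h x hV hU hx]

theorem restrict_iotaTilde (hVU : V ≤ U) (u : Dist U) :
    ETilde.restrict hVU (iotaTilde U u) = iotaTilde V (u.restrict V hVU) :=
  congrArg (negligible V).mkQ
    ((isRestriction_restrictELoc hVU _).unique hVU (isRestriction_iota hVU u))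

/-- Extension by zero identifies `𝓓(V)` with the test functions on `U` supported in `V`, and keeps
the underlying function on `ℝⁿ`. -/
theorem Dist.restrict_eq_zero_iff (hVU : V ≤ U) (u : Dist U) :
    u.restrict V hVU = 0 ↔ IsVanishingOn u (V : Set (Rn n)) := by
  constructor
  · intro h f hf
    -- The function `f` is bundled anew as a test function on `V`, with `hf` as its support
    -- condition; extending it back to `U` returns `f`.
    have h0 : u.restrict V hVU ⟨f, f.contDiff, f.hasCompactSupport, hf⟩ = 0 := by rw [h]; rfl
    rw [← h0]
    change u f = u (TestFunction.monoCLM ℂ _)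
    congr 1
    ext y
    rw [TestFunction.monoCLM_apply, if_pos ⟨le_rfl, hVU⟩]
    rfl
  · intro h
    ext f
    refine h _ ?_
    have e : ((TestFunction.monoCLM ℂ f : 𝓓(U, ℂ)) : Rn n → ℂ) = f := by
      rw [TestFunction.monoCLM_apply, if_pos ⟨le_rfl, hVU⟩]
    exact (congrArg tsupport e).trans_subset f.tsupport_subset

theorem supp_iotaTilde (u : Dist U) : u.supp = (iotaTilde U u).supp := by
  ext x
  refine and_congr_right fun hxU => ?_
  -- Injectivity is used over `V`, not over `U`: the restricted class is `ι̃_V (u|_V)`.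
  have key : ∀ (V : Opens (Rn n)) (hVU : V ≤ U),
      ETilde.restrict hVU (iotaTilde U u) = 0 ↔ IsVanishingOn u (V : Set (Rn n)) := fun V hVU => by
    rw [restrict_iotaTilde, map_eq_zero_iff _ (iotaTilde_injective V), Dist.restrict_eq_zero_iff]
  rw [mem_dsupport_iff_not_isVanishingOn]
  constructor
  · intro h V hVU hxV h0
    exact h V hxV V.isOpen ((key V hVU).1 h0)
  · intro h s hxs hs h0
    -- `dsupport` tests all open sets of `ℝⁿ` around `x`, `ETilde.supp` only those inside `U`.
    -- Intersecting with `U` suffices, since vanishing passes to smaller sets.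
    refine h (⟨s, hs⟩ ⊓ U) inf_le_right ⟨hxs, hxU⟩ ((key _ _).2 ?_)
    exact h0.mono inter_subset_left

end Colombeau

theorem mainTheorem8 (n : ℕ) (U : TopologicalSpace.Opens (EuclideanSpace ℝ (Fin n))) :
    Function.Injective (Colombeau.iotaTilde U) ∧
    (∀ (V : TopologicalSpace.Opens (EuclideanSpace ℝ (Fin n))) (hVU : V ≤ U)
      (u : Colombeau.Dist U),
      Colombeau.ETilde.restrict hVU (Colombeau.iotaTilde U u) =
        Colombeau.iotaTilde V (Colombeau.Dist.restrict u V hVU)) ∧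
    (∀ u : Colombeau.Dist U,
      Colombeau.Dist.supp u = Colombeau.ETilde.supp (Colombeau.iotaTilde U u)) := by
  exact ⟨Colombeau.iotaTilde_injective U, fun _ hVU u => Colombeau.restrict_iotaTilde hVU u,
    Colombeau.supp_iotaTilde⟩
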